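/- Let $k$ be a field, $q\in k$ a nonzero element, $a,b\ge 2$ integers, and $$A=k\langle X,Y\rangle/(X^a,\;XY-qYX,\;Y^b),$$ with $x,y$ the classes of $X,Y$. Let $A^{\mathrm e}=A\otimes_kA^{\mathrm{op}}$, and regard $A$ as a left $A^{\mathrm e}$-module via $(w\otimes z)\cdot m=wmz$. For $s\ge 0$ define in $A^{\mathrm e}$ $$\tau_1(s)=q^s(1\otimes x)-x\otimes 1,\qquad \tau_2(s)=1\otimes y-q^s(y\otimes 1),$$ $$\gamma_1(s)=\sum_{j=0}^{a-1}q^{js}(x^{a-1-j}\otimes x^j),\qquad \gamma_2(s)=\sum_{j=0}^{b-1}q^{js}(y^j\otimes y^{b-1-j}).$$ For $n\ge 0$ let $P_n=\bigoplus_{i=0}^nA^{\mathrm e}f^n_i$ be the free left $A^{\mathrm e}$-module of rank $n+1$ on generators $f^n_0,\dots,f^n_n$, and put $f^n_{-1}=f^n_{n+1}=0$. Let $\mu\colon P_0=A^{\mathrm e}\to A$ be the multiplication map $w\otimes z\mapsto wz$, and for $n\ge 1$ let $d_n\colon P_n\to P_{n-1}$ be the $A^{\mathrm e}$-linear map given,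 for $0\le i\le n$, by $$d_{2t}(f^{2t}_i)=\begin{cases}\gamma_2\big(\tfrac{ai}{2}\big)f^{2t-1}_i+\gamma_1\big(\tfrac{2bt-bi}{2}\big)f^{2t-1}_{i-1}& i\text{ even},\\[2pt]-\tau_2\big(\tfrac{ai-a+2}{2}\big)f^{2t-1}_i+\tau_1\big(\tfrac{2bt-bi-b+2}{2}\big)f^{2t-1}_{i-1}& i\text{ odd},\end{cases}$$ $$d_{2t+1}(f^{2t+1}_i)=\begin{cases}\tau_2\big(\tfrac{ai}{2}\big)f^{2t}_i+\gamma_1\big(\tfrac{2bt-bi+2}{2}\big)f^{2t}_{i-1}& i\text{ even},\\[2pt]-\gamma_2\big(\tfrac{ai-a+2}{2}\big)f^{2t}_i+\tau_1\big(\tfrac{2bt-bi+b}{2}\big)f^{2t}_{i-1}& i\text{ odd},\end{cases}$$ where a term whose generator is $0$ by the above convention is omitted. Then the sequence $$\mathbb P\colon\ \cdots\to P_2\xrightarrow{d_2}P_1\xrightarrow{d_1}P_0\xrightarrow{\mu}A\to 0$$ is exact, and it is a minimal projective resolution of the left $A^{\mathrm e}$-module $A$: every $P_n$ is projective, and $\mu$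 and every $d_n$ is a projective cover of its image (its kernel $N$ is superfluous, that is, $N+K=P_n$ for a submodule $K\subseteq P_n$ implies $K=P_n$). -/

import Mathlib

open scoped TensorProduct

noncomputable section

/-! ### Minimal projective resolutions -/

section Resolutions

variable {R : Type*} [Ring R]

/-- A submodule `N` of `P` is superfluous if `N + K = P` forces `K = P`. A surjection from a
projective module is a projective cover exactly when its kernel is superfluous. -/
def IsSuperfluous {P : Type*} [AddCommGroup P] [Module R P] (N : Submodule R P) : Prop :=
  ∀ K : Submodule R P, N ⊔ K = ⊤ → K = ⊤

/-- The sequence `⋯ → P 2 → P 1 → P 0 → M → 0` of left `R`-modules, with `d n : P (n + 1) → P n`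
and augmentation `ε : P 0 → M`, is exact (everywhere, including at `P 0` and at `M`). In
particular it is a complex. -/
structure IsExactAugmented {P : ℕ → Type*} [∀ n, AddCommGroup (P n)] [∀ n, Module R (P n)]
    {M : Type*} [AddCommGroup M] [Module R M]
    (d : ∀ n, P (n + 1) →ₗ[R] P n) (ε : P 0 →ₗ[R] M) : Prop where
  surjective : Function.Surjective ε
  exact_zero : Function.Exact (d 0) ε
  exact_succ : ∀ n, Function.Exact (d (n + 1)) (d n)

/-- `⋯ → P 2 → P 1 → P 0 → M → 0` is a minimal projective resolution of `M`: it is exact, every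
`P n` is projective, and every map is a projective cover of its image, that is, the kernels of
`ε` and of all the `d n` are superfluous. -/
structure IsMinimalProjectiveResolution {P : ℕ → Type*} [∀ n, AddCommGroup (P n)]
    [∀ n, Module R (P n)] {M : Type*} [AddCommGroup M] [Module R M]
    (d : ∀ n, P (n + 1) →ₗ[R] P n) (ε : P 0 →ₗ[R] M) : Prop
    extends IsExactAugmented d ε where
  projective : ∀ n, Module.Projective R (P n)
  superfluous_augmentation : IsSuperfluous (LinearMap.ker ε)
  superfluous : ∀ n, IsSuperfluous (LinearMap.ker (d n))

end Resolutions

/-! ### The quantum complete intersection -/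

namespace QuantumCI

/-- The defining relations `X ^ a = 0`, `X Y = q Y X`, `Y ^ b = 0`; the free generators `X` and `Y`
have index `0` and `1`. -/
inductive Rel (k : Type*) [Field k] (q : k) (a b : ℕ) :
    FreeAlgebra k (Fin 2) → FreeAlgebra k (Fin 2) → Prop
  | powX : Rel k q a b (FreeAlgebra.ι k 0 ^ a) 0
  | comm : Rel k q a b (FreeAlgebra.ι k 0 * FreeAlgebra.ι k 1)
      (q • (FreeAlgebra.ι k 1 * FreeAlgebra.ι k 0))
  | powY : Rel k q a b (FreeAlgebra.ι k 1 ^ b) 0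

/-- The algebra `A = k⟨X, Y⟩ / (X ^ a, X Y - q Y X, Y ^ b)`. -/
def Alg (k : Type*) [Field k] (q : k) (a b : ℕ) := RingQuot (Rel k q a b)

instance (k : Type*) [Field k] (q : k) (a b : ℕ) : Ring (Alg k q a b) :=
  inferInstanceAs (Ring (RingQuot (Rel k q a b)))

instance (k : Type*) [Field k] (q : k) (a b : ℕ) : Algebra k (Alg k q a b) :=
  inferInstanceAs (Algebra k (RingQuot (Rel k q a b)))

/-- The enveloping algebra `Aᵉ = A ⊗ Aᵒᵖ`. -/
def Env (k : Type*) [Field k] (q : k) (a b : ℕ) := Alg k q a b ⊗[k] (Alg k q a b)ᵐᵒᵖ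

instance (k : Type*) [Field k] (q : k) (a b : ℕ) : Ring (Env k q a b) :=
  inferInstanceAs (Ring (Alg k q a b ⊗[k] (Alg k q a b)ᵐᵒᵖ))

instance (k : Type*) [Field k] (q : k) (a b : ℕ) : Algebra k (Env k q a b) :=
  inferInstanceAs (Algebra k (Alg k q a b ⊗[k] (Alg k q a b)ᵐᵒᵖ))

variable (k : Type*) [Field k] (q : k) (a b : ℕ)

/-- The class of `X` in `A`. -/
def x : Alg k q a b := RingQuot.mkAlgHom k (Rel k q a b) (FreeAlgebra.ι k 0)

/-- The class of `Y` in `A`. -/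
def y : Alg k q a b := RingQuot.mkAlgHom k (Rel k q a b) (FreeAlgebra.ι k 1)

/-- `A` as a left `Aᵉ`-module, that is, as a bimodule over itself: `(w ⊗ z) • m = w m z`. -/
instance : Module (Env k q a b) (Alg k q a b) :=
  TensorProduct.Algebra.module (R := k) (A := Alg k q a b) (B := (Alg k q a b)ᵐᵒᵖ)

/-- The element `w ⊗ z` of `Aᵉ`. -/
def tens (w z : Alg k q a b) : Env k q a b :=
  (w ⊗ₜ[k] MulOpposite.op z : Alg k q a b ⊗[k] (Alg k q a b)ᵐᵒᵖ)

lemma tens_smul (w z m : Alg k q a b) : tens k q a b w z • m = w * m * z := by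
  change w • (MulOpposite.op z • m) = w * m * z
  simp [mul_assoc]

/-- `τ₁(s) = q ^ s (1 ⊗ x) - x ⊗ 1`. -/
def tau₁ (s : ℕ) : Env k q a b :=
  q ^ s • tens k q a b 1 (x k q a b) - tens k q a b (x k q a b) 1

/-- `τ₂(s) = 1 ⊗ y - q ^ s (y ⊗ 1)`. -/
def tau₂ (s : ℕ) : Env k q a b :=
  tens k q a b 1 (y k q a b) - q ^ s • tens k q a b (y k q a b) 1

/-- `γ₁(s) = ∑_{j < a} q ^ (j s) (x ^ (a - 1 - j) ⊗ x ^ j)`. -/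
def gamma₁ (s : ℕ) : Env k q a b :=
  ∑ j ∈ Finset.range a, q ^ (j * s) • tens k q a b (x k q a b ^ (a - 1 - j)) (x k q a b ^ j)

/-- `γ₂(s) = ∑_{j < b} q ^ (j s) (y ^ j ⊗ y ^ (b - 1 - j))`. -/
def gamma₂ (s : ℕ) : Env k q a b :=
  ∑ j ∈ Finset.range b, q ^ (j * s) • tens k q a b (y k q a b ^ j) (y k q a b ^ (b - 1 - j))

/-- The free left `Aᵉ`-module `P_n` of rank `n + 1`. -/
abbrev P (n : ℕ) : Type _ := Fin (n + 1) → Env k q a b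

/-- The generator `f^n_i = ε(i, n - i)` of `P_n` for `0 ≤ i ≤ n`, and `0` for all other integers
`i`; in particular `f^n_{-1} = f^n_{n+1} = 0`. -/
def gen (n : ℕ) (i : ℤ) : P k q a b n := fun l => if (l : ℤ) = i then 1 else 0

/-- The twist `m r` at the even index `2 r`, and `m r + 1` at the odd index `2 r + 1`. -/
def twist (m l : ℕ) : ℕ := m * (l / 2) + l % 2

/-- Coefficient of the row map `ε(i, j) ↦ rowCoeff i j • ε(i - 1, j)` of the double complex. Row
`j` carries the twist `b s` if `j = 2 s`, and `b s + 1` if `j = 2 s + 1`. -/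
def rowCoeff (i j : ℕ) : Env k q a b :=
  if Even i then gamma₁ k q a b (twist b j) else tau₁ k q a b (twist b j)

/-- Coefficient of the column map `ε(i, j) ↦ colCoeff i j • ε(i, j - 1)` of the double complex.
Column `i` carries the twist `a r` if `i = 2 r`, and `a r + 1` together with a sign if
`i = 2 r + 1`. -/
def colCoeff (i j : ℕ) : Env k q a b :=
  if Even i then
    if Even j then gamma₂ k q a b (twist a i) else tau₂ k q a b (twist a i)
  else
    if Even j then -gamma₂ k q a b (twist a i) else -tau₂ k q a b (twist a i)

/-- The differential `d_{n+1} : P_{n+1} → P_n` of the total complex: the `Aᵉ`-linear map sending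
`f^{n+1}_i = ε(i, j)`, with `i + j = n + 1`, to the sum of its images under the column map and
under the row map. -/
def d (n : ℕ) : P k q a b (n + 1) →ₗ[Env k q a b] P k q a b n :=
  Fintype.linearCombination (Env k q a b) fun i : Fin (n + 2) =>
    colCoeff k q a b i (n + 1 - i) • gen k q a b n i +
      rowCoeff k q a b i (n + 1 - i) • gen k q a b n (i - 1)

/-- The multiplication map `μ : P_0 = Aᵉ → A`, `w ⊗ z ↦ w z`, as an `Aᵉ`-linear map. -/
def mu : P k q a b 0 →ₗ[Env k q a b] Alg k q a b :=
  Fintype.linearCombination (Env k q a b) fun _ : Fin 1 => (1 : Alg k q a b)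

lemma mu_tens (w z : Alg k q a b) : mu k q a b (fun _ => tens k q a b w z) = w * z := by
  simp [mu, Fintype.linearCombination_apply, tens_smul]

end QuantumCI

end

/-! The `P_n` form the total complex of a double complex with one copy of `Aᵉ` at each ε(i, j). Row
maps involve only `x`, column maps only `y`, and the powers of `q` are chosen so that the squares
anticommute (`colCoeff_mul_rowCoeff`).

A left-linear map between copies of `Aᵉ` is a right multiplication. For a row of twist `s`, put u =
x ⊗ 1 and v = q^s (1 ⊗ x). These commute, u^a = v^a = 0, τ₁ = v - u, and γ₁ is the sum of the
u^(a-1-j) v^j. Since `Aᵉ` is free over A ⊗ k[y] on 1, v, …, v^(a-1) (`isExpansion_top`), the row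
behaves like the 2-periodic resolution over a truncated polynomial ring: it is exact in positive
degrees (`exists_eq_mul_rowCoeff`), and `rightY` represents its cokernel. Column 0 has twist 0 and
acts on these cokernels. The same argument with `y` (`isExpansion_rightY`) shows that this column is
exact in positive degrees, with cokernel A ⊗ 1 ≅ A. A cycle of the total complex is then reduced to
zero one entry at a time (`exists_d_eq_of_forall_lt`).

For minimality, x ⊗ 1, 1 ⊗ x, y ⊗ 1 and 1 ⊗ y are nilpotent and normal, hence lie in the Jacobson
radical. As a, b ≥ 2, so do all coefficients of the differential, and Nakayama's lemma applies. -/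

noncomputable section

namespace QuantumCI

/-! ### Relations in `A` and spanning by ordered monomials -/

section Algebra

variable {k : Type*} [Field k] {q : k} {a b : ℕ}

lemma x_pow : x k q a b ^ a = 0 := by
  have h := RingQuot.mkAlgHom_rel k (Rel.powX (k := k) (q := q) (a := a) (b := b))
  rw [map_pow, map_zero] at h
  exact h

lemma y_pow : y k q a b ^ b = 0 := by
  have h := RingQuot.mkAlgHom_rel k (Rel.powY (k := k) (q := q) (a := a) (b := b))
  rw [map_pow, map_zero] at h
  exact h

lemma x_mul_y : x k q a b * y k q a b = q • (y k q a b * x k q a b) := by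
  have h := RingQuot.mkAlgHom_rel k (Rel.comm (k := k) (q := q) (a := a) (b := b))
  rw [map_mul, map_smul, map_mul] at h
  exact h

lemma alg_induction {p : Alg k q a b → Prop} (hx : p (x k q a b)) (hy : p (y k q a b))
    (hc : ∀ c : k, p (algebraMap k _ c)) (hadd : ∀ z w, p z → p w → p (z + w))
    (hmul : ∀ z w, p z → p w → p (z * w)) (z : Alg k q a b) : p z := by
  obtain ⟨w, rfl⟩ := RingQuot.mkAlgHom_surjective k (Rel k q a b) z
  induction w using FreeAlgebra.induction with
  | grade0 c =>
    rw [AlgHom.commutes]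
    exact hc c
  | grade1 i =>
    fin_cases i
    exacts [hx, hy]
  | mul u v hu hv =>
    rw [map_mul]
    exact hmul _ _ hu hv
  | add u v hu hv =>
    rw [map_add]
    exact hadd _ _ hu hv

lemma x_mul_y_pow (l : ℕ) : x k q a b * y k q a b ^ l = q ^ l • (y k q a b ^ l * x k q a b) := by
  induction l with
  | zero => simp
  | succ l ih =>
    rw [pow_succ, ← mul_assoc, ih, smul_mul_assoc, mul_assoc, x_mul_y, mul_smul_comm, smul_smul,
      ← pow_succ, ← mul_assoc]

lemma x_pow_mul_y (j : ℕ) : x k q a b ^ j * y k q a b = q ^ j • (y k q a b * x k q a b ^ j) := by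
  induction j with
  | zero => simp
  | succ j ih =>
    rw [pow_succ', mul_assoc, ih, mul_smul_comm, ← mul_assoc, x_mul_y, smul_mul_assoc, smul_smul,
      ← pow_succ, mul_assoc]

/-- The span of the ordered monomials is everything. -/
lemma span_monomials (hq : q ≠ 0) :
    Submodule.span k (Set.range fun p : ℕ × ℕ => x k q a b ^ p.1 * y k q a b ^ p.2) = ⊤ := by
  set T := Submodule.span k (Set.range fun p : ℕ × ℕ => x k q a b ^ p.1 * y k q a b ^ p.2)
  have hmem (j l : ℕ) : x k q a b ^ j * y k q a b ^ l ∈ T :=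
    Submodule.subset_span ⟨(j, l), rfl⟩
  -- `T` is a left ideal; as it contains 1, it is everything. Moving `y` to the right past x^j
  -- requires `q` to be invertible.
  have key (z : Alg k q a b) : ∀ m ∈ T, z * m ∈ T := by
    induction z using alg_induction with
    | hx =>
      intro m hm
      induction hm using Submodule.span_induction with
      | mem _ h =>
        obtain ⟨⟨j, l⟩, rfl⟩ := h
        dsimp only
        rw [← mul_assoc, ← pow_succ']
        exact hmem _ _
      | zero => simp
      | add u v _ _ hu hv => rw [mul_add]; exact T.add_mem hu hv
      | smul c u _ hu => rw [mul_smul_comm]; exact T.smul_mem c hu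
    | hy =>
      intro m hm
      induction hm using Submodule.span_induction with
      | mem _ h =>
        obtain ⟨⟨j, l⟩, rfl⟩ := h
        have h1 : y k q a b * x k q a b ^ j = (q ^ j)⁻¹ • (x k q a b ^ j * y k q a b) := by
          rw [x_pow_mul_y, smul_smul, inv_mul_cancel₀ (pow_ne_zero j hq), one_smul]
        dsimp only
        rw [← mul_assoc, h1, smul_mul_assoc, mul_assoc, ← pow_succ']
        exact T.smul_mem _ (hmem _ _)
      | zero => simp
      | add u v _ _ hu hv => rw [mul_add]; exact T.add_mem hu hv
      | smul c u _ hu => rw [mul_smul_comm]; exact T.smul_mem c hu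
    | hc c =>
      intro m hm
      rw [← Algebra.smul_def]
      exact T.smul_mem c hm
    | hadd u v hu hv =>
      intro m hm
      rw [add_mul]
      exact T.add_mem (hu m hm) (hv m hm)
    | hmul u v hu hv =>
      intro m hm
      rw [mul_assoc]
      exact hu _ (hv m hm)
  rw [eq_top_iff]
  intro z _
  have h1 : (1 : Alg k q a b) ∈ T := by simpa using hmem 0 0
  simpa using key z 1 h1

end Algebra

/-! ### Linear independence of the truncated ordered monomials -/

section Coordinates

variable (k : Type*) [Field k] (q : k) (a b : ℕ)

/-- Multiplication by `x` on truncated ordered monomials. -/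
def monX : Module.End k (ℕ × ℕ →₀ k) :=
  Finsupp.linearCombination k fun p : ℕ × ℕ =>
    if p.1 + 1 < a then Finsupp.single (p.1 + 1, p.2) 1 else 0

/-- Multiplication by `y` on truncated ordered monomials. -/
def monY : Module.End k (ℕ × ℕ →₀ k) :=
  Finsupp.linearCombination k fun p : ℕ × ℕ =>
    -- The scalar comes from y x^i = q^(-i) x^i y.
    if p.2 + 1 < b then Finsupp.single (p.1, p.2 + 1) ((q ^ p.1)⁻¹) else 0

variable {k q a b}

lemma monX_single (i j : ℕ) (c : k) : monX k a (Finsupp.single (i, j) c) =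
    if i + 1 < a then Finsupp.single (i + 1, j) c else 0 := by
  simp only [monX, Finsupp.linearCombination_single]
  split_ifs <;> simp

lemma monY_single (i j : ℕ) (c : k) : monY k q b (Finsupp.single (i, j) c) =
    if j + 1 < b then Finsupp.single (i, j + 1) ((q ^ i)⁻¹ * c) else 0 := by
  simp only [monY, Finsupp.linearCombination_single]
  split_ifs <;> simp [mul_comm]

/-- The exponent is positive because for the zeroth power the formula fails on basis vectors with `a
≤ i`. -/
lemma monX_pow_single (n i j : ℕ) (c : k) : (monX k a ^ (n + 1)) (Finsupp.single (i, j) c) =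
    if i + (n + 1) < a then Finsupp.single (i + (n + 1), j) c else 0 := by
  induction n with
  | zero => simpa using monX_single i j c
  | succ n ih =>
    rw [pow_succ', Module.End.mul_apply, ih]
    split_ifs with h1 h2 h2
    · rw [monX_single, if_pos (by omega)]; rfl
    · rw [monX_single, if_neg (by omega)]
    · omega
    · simp

lemma monY_pow_single (n i j : ℕ) (c : k) : (monY k q b ^ (n + 1)) (Finsupp.single (i, j) c) =
    if j + (n + 1) < b then Finsupp.single (i, j + (n + 1)) ((q ^ i)⁻¹ ^ (n + 1) * c) else 0 := by
  induction n with
  | zero => simpa using monY_single i j c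
  | succ n ih =>
    rw [pow_succ', Module.End.mul_apply, ih]
    split_ifs with h1 h2 h2
    · rw [monY_single, if_pos (by omega), ← mul_assoc, ← pow_succ']; rfl
    · rw [monY_single, if_neg (by omega)]
    · omega
    · simp

/-- The representation of `A` on truncated ordered monomials. -/
def monRep (hq : q ≠ 0) (ha : a ≠ 0) (hb : b ≠ 0) :
    Alg k q a b →ₐ[k] Module.End k (ℕ × ℕ →₀ k) :=
  RingQuot.liftAlgHom k ⟨FreeAlgebra.lift k ![monX k a, monY k q b], by
    intro u v h
    cases h with
    | powX =>
      obtain ⟨n, rfl⟩ := Nat.exists_eq_succ_of_ne_zero ha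
      rw [map_pow, map_zero, FreeAlgebra.lift_ι_apply]
      refine Finsupp.lhom_ext fun p c => ?_
      rw [Matrix.cons_val_zero, Nat.succ_eq_add_one, monX_pow_single, if_neg (by omega)]
      simp
    | powY =>
      obtain ⟨n, rfl⟩ := Nat.exists_eq_succ_of_ne_zero hb
      rw [map_pow, map_zero, FreeAlgebra.lift_ι_apply]
      refine Finsupp.lhom_ext fun p c => ?_
      rw [Matrix.cons_val_one, Matrix.cons_val_fin_one, Nat.succ_eq_add_one, monY_pow_single,
        if_neg (by omega)]
      simp
    | comm =>
      simp only [map_mul, map_smul, FreeAlgebra.lift_ι_apply, Matrix.cons_val_zero,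
        Matrix.cons_val_one, Matrix.cons_val_fin_one]
      refine Finsupp.lhom_ext fun p c => ?_
      obtain ⟨i, j⟩ := p
      rw [LinearMap.smul_apply, Module.End.mul_apply, Module.End.mul_apply, monX_single,
        monY_single]
      split_ifs with h1 h2 h2
      · rw [monX_single, monY_single, if_pos h2, if_pos h1, Finsupp.smul_single, smul_eq_mul,
          pow_succ, mul_inv]
        congr 1
        field_simp
      · rw [monX_single, if_neg h2]; simp
      · rw [monY_single, if_neg h1]; simp
      · simp⟩

lemma monRep_x (hq : q ≠ 0) (ha : a ≠ 0) (hb : b ≠ 0) :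
    monRep hq ha hb (x k q a b) = monX k a := by
  refine (RingQuot.liftAlgHom_mkAlgHom_apply ..).trans ?_
  simp

lemma monRep_y (hq : q ≠ 0) (ha : a ≠ 0) (hb : b ≠ 0) :
    monRep hq ha hb (y k q a b) = monY k q b := by
  refine (RingQuot.liftAlgHom_mkAlgHom_apply ..).trans ?_
  simp

/-- Acting on the vector that stands for 1 turns the monomials into distinct basis vectors, so
coefficients can be read off. -/
lemma monRep_monomial (hq : q ≠ 0) (ha : a ≠ 0) (hb : b ≠ 0) {j l : ℕ} (hj : j < a) (hl : l < b) :
    monRep hq ha hb (x k q a b ^ j * y k q a b ^ l) (Finsupp.single (0, 0) 1) =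
      Finsupp.single (j, l) 1 := by
  have hY : (monY k q b ^ l) (Finsupp.single (0, 0) 1) = Finsupp.single (0, l) 1 := by
    cases l with
    | zero => simp
    | succ l => rw [monY_pow_single, if_pos (by omega)]; simp
  rw [map_mul, map_pow, map_pow, monRep_x, monRep_y, Module.End.mul_apply, hY]
  cases j with
  | zero => simp
  | succ j => rw [monX_pow_single, if_pos (by omega)]; simp

/-- The coefficient of `x ^ j * y ^ l`. -/
def coord (hq : q ≠ 0) (ha : a ≠ 0) (hb : b ≠ 0) (j l : ℕ) : Alg k q a b →ₗ[k] k :=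
  Finsupp.lapply (j, l) ∘ₗ LinearMap.applyₗ (Finsupp.single (0, 0) 1) ∘ₗ
    (monRep hq ha hb).toLinearMap

lemma coord_monomial (hq : q ≠ 0) (ha : a ≠ 0) (hb : b ≠ 0) (j l : ℕ) {j' l' : ℕ}
    (hj : j' < a) (hl : l' < b) :
    coord hq ha hb j l (x k q a b ^ j' * y k q a b ^ l') = if j' = j ∧ l' = l then 1 else 0 := by
  simp only [coord, LinearMap.comp_apply, AlgHom.toLinearMap_apply, LinearMap.applyₗ_apply_apply,
    monRep_monomial hq ha hb hj hl, Finsupp.lapply_apply, Finsupp.single_apply, Prod.mk.injEq]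

end Coordinates

/-! ### The enveloping algebra as a free left `A`-module -/

section Envelope

variable {k : Type*} [Field k] {q : k} {a b : ℕ}

lemma tens_mul (w z w' z' : Alg k q a b) :
    tens k q a b w z * tens k q a b w' z' = tens k q a b (w * w') (z' * z) :=
  Algebra.TensorProduct.tmul_mul_tmul w w' (MulOpposite.op z) (MulOpposite.op z')

lemma tens_one : tens k q a b 1 1 = 1 := rfl

lemma tens_add_left (w w' z : Alg k q a b) :
    tens k q a b (w + w') z = tens k q a b w z + tens k q a b w' z :=
  TensorProduct.add_tmul ..

lemma tens_add_right (w z z' : Alg k q a b) :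
    tens k q a b w (z + z') = tens k q a b w z + tens k q a b w z' :=
  TensorProduct.tmul_add ..

lemma tens_zero_left (z : Alg k q a b) : tens k q a b 0 z = 0 := TensorProduct.zero_tmul ..

lemma tens_zero_right (w : Alg k q a b) : tens k q a b w 0 = 0 := TensorProduct.tmul_zero ..

lemma tens_smul_left (c : k) (w z : Alg k q a b) :
    tens k q a b (c • w) z = c • tens k q a b w z := (TensorProduct.smul_tmul' c w _).symm

lemma tens_smul_right (c : k) (w z : Alg k q a b) :
    tens k q a b w (c • z) = c • tens k q a b w z := TensorProduct.tmul_smul c w (MulOpposite.op z)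

lemma tens_pow (w z : Alg k q a b) (n : ℕ) :
    tens k q a b w z ^ n = tens k q a b (w ^ n) (z ^ n) := by
  induction n with
  | zero => simp [tens_one]
  | succ n ih => rw [pow_succ, ih, tens_mul, pow_succ, pow_succ']

/-- An additive property that holds for `w ⊗ x ^ j y ^ l` holds everywhere. -/
lemma env_induction (hq : q ≠ 0) {p : Env k q a b → Prop} (h0 : p 0)
    (hadd : ∀ s t, p s → p t → p (s + t))
    (hm : ∀ w j l, p (tens k q a b w (x k q a b ^ j * y k q a b ^ l))) (s : Env k q a b) : p s := by
  refine TensorProduct.induction_on (motive := p) s h0 (fun w z => ?_) hadd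
  obtain ⟨z, rfl⟩ := MulOpposite.op_surjective z
  change p (tens k q a b w z)
  have hz : z ∈ Submodule.span k
      (Set.range fun p : ℕ × ℕ => x k q a b ^ p.1 * y k q a b ^ p.2) := by
    rw [span_monomials hq]; trivial
  -- Since `p` is only additive, a scalar on the right factor is absorbed into `w`, which must
  -- therefore vary.
  induction hz using Submodule.span_induction generalizing w with
  | mem _ h =>
    obtain ⟨⟨j, l⟩, rfl⟩ := h
    exact hm _ _ _
  | zero => rwa [tens_zero_right]
  | add u v _ _ hu hv =>
    rw [tens_add_right]
    exact hadd _ _ (hu _) (hv _)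
  | smul c u _ hu =>
    rw [tens_smul_right, ← tens_smul_left]
    exact hu _

/-- The coefficient in `A` of `1 ⊗ x ^ j y ^ l`. -/
def envCoord (hq : q ≠ 0) (ha : a ≠ 0) (hb : b ≠ 0) (j l : ℕ) : Env k q a b →+ Alg k q a b :=
  ((TensorProduct.rid k (Alg k q a b)).toLinearMap ∘ₗ
    LinearMap.lTensor (Alg k q a b) (coord hq ha hb j l ∘ₗ
      (MulOpposite.opLinearEquiv k).symm.toLinearMap)).toAddMonoidHom

lemma envCoord_tens (hq : q ≠ 0) (ha : a ≠ 0) (hb : b ≠ 0) (j l : ℕ) (w z : Alg k q a b) :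
    envCoord hq ha hb j l (tens k q a b w z) = coord hq ha hb j l z • w := by
  change (TensorProduct.rid k (Alg k q a b)) (LinearMap.lTensor (Alg k q a b)
    (coord hq ha hb j l ∘ₗ (MulOpposite.opLinearEquiv k).symm.toLinearMap)
      (w ⊗ₜ[k] MulOpposite.op z)) = _
  simp

/-- `Aᵉ` is free over `A` on the elements `1 ⊗ x ^ j y ^ l`: independence. -/
lemma env_independent (hq : q ≠ 0) (ha : a ≠ 0) (hb : b ≠ 0) (w : ℕ → ℕ → Alg k q a b)
    (h : ∑ j ∈ Finset.range a, ∑ l ∈ Finset.range b,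
      tens k q a b (w j l) (x k q a b ^ j * y k q a b ^ l) = 0)
    {j l : ℕ} (hj : j < a) (hl : l < b) : w j l = 0 := by
  have h1 := congrArg (envCoord hq ha hb j l) h
  rw [map_zero, map_sum, Finset.sum_eq_single j, map_sum, Finset.sum_eq_single l, envCoord_tens,
    coord_monomial hq ha hb j l hj hl] at h1
  · simpa using h1
  · intro l' hl' hne
    rw [envCoord_tens, coord_monomial hq ha hb j l hj (Finset.mem_range.1 hl'), if_neg (by tauto),
      zero_smul]
  · intro h; exact absurd (Finset.mem_range.2 hl) h
  · intro j' hj' hne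
    rw [map_sum]
    refine Finset.sum_eq_zero fun l' hl' => ?_
    rw [envCoord_tens, coord_monomial hq ha hb j l (Finset.mem_range.1 hj') (Finset.mem_range.1 hl'),
      if_neg (by tauto), zero_smul]
  · intro h; exact absurd (Finset.mem_range.2 hj) h

end Envelope

/-! ### Annihilators of v - u and of its complementary geometric sum -/

section Expansion

variable {S : Type*} [Ring S]

/-- Every element of `M` has an expansion `∑_{j < a} c_j v ^ j` with coefficients in `N`, and such
expansions are unique. -/
structure IsExpansion (M N : AddSubgroup S) (v : S) (a : ℕ) : Prop where
  exists_eq : ∀ w ∈ M, ∃ c : ℕ → S, (∀ j, c j ∈ N) ∧ w = ∑ j ∈ Finset.range a, c j * v ^ j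
  eq_zero : ∀ c : ℕ → S, (∀ j, c j ∈ N) → ∑ j ∈ Finset.range a, c j * v ^ j = 0 →
    ∀ j < a, c j = 0

variable {M N : AddSubgroup S} {u v : S} {a : ℕ}

lemma mul_pow_mem_of_mul_mem (hu : ∀ n ∈ N, n * u ∈ N) {n : S} (hn : n ∈ N) (i : ℕ) :
    n * u ^ i ∈ N := by
  induction i with
  | zero => simpa
  | succ i ih => rw [pow_succ, ← mul_assoc]; exact hu _ ih

namespace IsExpansion

/-- Comparing coefficients of v^(j+1) in w (v - u) = 0 gives c_j = c_(j+1) u, so the top coefficient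
determines all the others. -/
lemma exists_eq_mul_geom_sum (h : IsExpansion M N v a) (ha : a ≠ 0) (hu : ∀ n ∈ N, n * u ∈ N)
    (huv : Commute u v) (hv : v ^ a = 0) {w : S} (hw : w ∈ M) (h0 : w * (v - u) = 0) :
    ∃ n ∈ N, w = n * ∑ j ∈ Finset.range a, u ^ (a - 1 - j) * v ^ j := by
  obtain ⟨m, rfl⟩ := Nat.exists_eq_succ_of_ne_zero ha
  obtain ⟨c, hc, rfl⟩ := h.exists_eq w hw
  have hstep : ∀ j < m, c j = c (j + 1) * u := by
    -- These are the coefficients of w (v - u): multiplication by `v` shifts the indices and loses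
    -- the top term since v^a = 0.
    have h1 := h.eq_zero (fun j => (if j = 0 then 0 else c (j - 1)) - c j * u)
      (fun j => by
        refine N.sub_mem ?_ (hu _ (hc j))
        split_ifs
        exacts [N.zero_mem, hc _]) (by
        refine Eq.trans ?_ h0
        rw [mul_sub, Finset.sum_mul, Finset.sum_mul]
        simp_rw [sub_mul]
        rw [Finset.sum_sub_distrib]
        congr 1
        · rw [Finset.sum_range_succ', Finset.sum_range_succ]
          have h2 : c m * v ^ m * v = 0 := by
            rw [mul_assoc, ← pow_succ, ← Nat.succ_eq_add_one, hv, mul_zero]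
          rw [h2, add_zero]
          simp [pow_succ, mul_assoc]
        · refine Finset.sum_congr rfl fun j _ => ?_
          rw [mul_assoc, mul_assoc, (huv.pow_right j).eq])
    intro j hj
    have h2 := h1 (j + 1) (by omega)
    simpa [sub_eq_zero] using h2
  have hpow : ∀ i ≤ m, c (m - i) = c m * u ^ i := by
    intro i
    induction i with
    | zero => simp
    | succ i ih =>
      intro hi
      rw [hstep _ (by omega), show m - (i + 1) + 1 = m - i by omega, ih (by omega), pow_succ,
        mul_assoc]
  refine ⟨c m, hc m, ?_⟩
  rw [Finset.mul_sum]
  refine Finset.sum_congr rfl fun j hj => ?_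
  have hj' := Finset.mem_range.1 hj
  rw [← mul_assoc, show m.succ - 1 - j = m - j by omega, ← hpow _ (by omega),
    show m - (m - j) = j by omega]

/-- Substituting `u` for `v` in the expansion of `w` gives the remainder, because v - u divides v^j
- u^j. -/
lemma exists_eq_add_mul_sub (h : IsExpansion M N v a) (hu : ∀ n ∈ N, n * u ∈ N)
    (huv : Commute u v) {w : S} (hw : w ∈ M) : ∃ n ∈ N, ∃ r, w = n + r * (v - u) := by
  obtain ⟨c, hc, rfl⟩ := h.exists_eq w hw
  refine ⟨∑ j ∈ Finset.range a, c j * u ^ j,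
    N.sum_mem fun j _ => mul_pow_mem_of_mul_mem hu (hc j) j,
    ∑ j ∈ Finset.range a, c j * ∑ i ∈ Finset.range j, v ^ i * u ^ (j - 1 - i), ?_⟩
  rw [Finset.sum_mul, ← Finset.sum_add_distrib]
  refine Finset.sum_congr rfl fun j _ => ?_
  rw [mul_assoc, huv.symm.geom_sum₂_mul, mul_sub]
  abel

/-- The coefficient of v^(a-1) in the product is `n` itself. -/
lemma eq_zero_of_mul_geom_sum (h : IsExpansion M N v a) (ha : a ≠ 0) (hu : ∀ n ∈ N, n * u ∈ N)
    {n : S} (hn : n ∈ N)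
    (h0 : n * ∑ j ∈ Finset.range a, u ^ (a - 1 - j) * v ^ j = 0) : n = 0 := by
  have h1 := h.eq_zero (fun j => n * u ^ (a - 1 - j))
    (fun j => mul_pow_mem_of_mul_mem hu hn _) (by
      rw [← h0, Finset.mul_sum]
      simp_rw [mul_assoc]) (a - 1) (by omega)
  simpa using h1

end IsExpansion

end Expansion

/-! ### Identities between the coefficients τ and γ -/

section Coefficients

variable {k : Type*} [Field k] {q : k} {a b : ℕ}

lemma x_pow_mul_y_pow (j l : ℕ) :
    x k q a b ^ j * y k q a b ^ l = q ^ (j * l) • (y k q a b ^ l * x k q a b ^ j) := by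
  induction j with
  | zero => simp
  | succ j ih =>
    rw [pow_succ', mul_assoc, ih, mul_smul_comm, ← mul_assoc, x_mul_y_pow, smul_mul_assoc,
      smul_smul, ← pow_add, mul_assoc, ← pow_succ']
    congr 2
    ring

lemma commute_left_right (w z : Alg k q a b) : Commute (tens k q a b w 1) (tens k q a b 1 z) := by
  simp [Commute, SemiconjBy, tens_mul]

lemma gamma₁_eq (s : ℕ) : gamma₁ k q a b s = ∑ j ∈ Finset.range a,
    tens k q a b (x k q a b) 1 ^ (a - 1 - j) * (q ^ s • tens k q a b 1 (x k q a b)) ^ j := by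
  refine Finset.sum_congr rfl fun j _ => ?_
  rw [smul_pow, mul_smul_comm, tens_pow, tens_pow, tens_mul, ← pow_mul, mul_comm s]
  simp

/-- Reversing the summation puts γ₂ in the geometric form with u = q^s (y ⊗ 1) and v = 1 ⊗ y, for
which τ₂ = v - u. -/
lemma gamma₂_eq (s : ℕ) : gamma₂ k q a b s = ∑ j ∈ Finset.range b,
    (q ^ s • tens k q a b (y k q a b) 1) ^ (b - 1 - j) * tens k q a b 1 (y k q a b) ^ j := by
  rw [← Finset.sum_range_reflect]
  refine Finset.sum_congr rfl fun j hj => ?_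
  have hj' := Finset.mem_range.1 hj
  rw [show b - 1 - (b - 1 - j) = j by omega, smul_pow, smul_mul_assoc, tens_pow, tens_pow,
    tens_mul, ← pow_mul, mul_comm s]
  simp

lemma pow_left_x : tens k q a b (x k q a b) 1 ^ a = 0 := by
  rw [tens_pow, x_pow, tens_zero_left]

lemma pow_right_x : tens k q a b 1 (x k q a b) ^ a = 0 := by
  rw [tens_pow, x_pow, tens_zero_right]

lemma pow_left_y : tens k q a b (y k q a b) 1 ^ b = 0 := by
  rw [tens_pow, y_pow, tens_zero_left]

lemma pow_right_y : tens k q a b 1 (y k q a b) ^ b = 0 := by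
  rw [tens_pow, y_pow, tens_zero_right]

lemma tau₁_mul_gamma₁ (s : ℕ) : tau₁ k q a b s * gamma₁ k q a b s = 0 := by
  have h : Commute (tens k q a b (x k q a b) 1) (q ^ s • tens k q a b 1 (x k q a b)) :=
    (commute_left_right _ _).smul_right _
  rw [gamma₁_eq, tau₁, ← neg_sub, neg_mul]
  simp_rw [(h.pow_pow _ _).eq]
  rw [← neg_mul, neg_sub, h.symm.mul_geom_sum₂, smul_pow, pow_left_x, pow_right_x, smul_zero,
    sub_zero]

lemma gamma₁_mul_tau₁ (s : ℕ) : gamma₁ k q a b s * tau₁ k q a b s = 0 := by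
  have h : Commute (tens k q a b (x k q a b) 1) (q ^ s • tens k q a b 1 (x k q a b)) :=
    (commute_left_right _ _).smul_right _
  rw [gamma₁_eq, tau₁]
  simp_rw [(h.pow_pow _ _).eq]
  rw [h.symm.geom_sum₂_mul, smul_pow, pow_left_x, pow_right_x, smul_zero, sub_zero]

lemma tau₂_mul_gamma₂ (s : ℕ) : tau₂ k q a b s * gamma₂ k q a b s = 0 := by
  have h : Commute (q ^ s • tens k q a b (y k q a b) 1) (tens k q a b 1 (y k q a b)) :=
    (commute_left_right _ _).smul_left _
  rw [gamma₂_eq, tau₂]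
  simp_rw [(h.pow_pow _ _).eq]
  rw [h.symm.mul_geom_sum₂, smul_pow, pow_left_y, pow_right_y, smul_zero, sub_zero]

lemma gamma₂_mul_tau₂ (s : ℕ) : gamma₂ k q a b s * tau₂ k q a b s = 0 := by
  have h : Commute (q ^ s • tens k q a b (y k q a b) 1) (tens k q a b 1 (y k q a b)) :=
    (commute_left_right _ _).smul_left _
  rw [gamma₂_eq, tau₂]
  simp_rw [(h.pow_pow _ _).eq]
  rw [h.symm.geom_sum₂_mul, smul_pow, pow_left_y, pow_right_y, smul_zero, sub_zero]

/-- This relation and the next three have one cause: moving a factor past another shifts its twist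
by the degree of the other factor. That degree is 1 for a τ, b - 1 for γ₂ and a - 1 for γ₁, which is
why `twist` grows alternately by 1 and by m - 1. -/
lemma tau₂_mul_tau₁ (α β : ℕ) : tau₂ k q a b (α + 1) * tau₁ k q a b β =
    tau₁ k q a b (β + 1) * tau₂ k q a b α := by
  simp only [tau₁, tau₂, mul_sub, sub_mul, smul_mul_assoc, mul_smul_comm, tens_mul, one_mul,
    mul_one, x_mul_y, tens_smul_left, tens_smul_right, smul_sub, smul_smul]
  rw [show q ^ β * q ^ (α + 1) = q ^ α * q ^ (β + 1) by ring,
    show q ^ β * q = q ^ (β + 1) by ring, show q ^ α * q = q ^ (α + 1) by ring]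
  abel

lemma gamma₂_mul_tau₁ (α β : ℕ) : gamma₂ k q a b (α + 1) * tau₁ k q a b (β + 1) =
    tau₁ k q a b (β + b) * gamma₂ k q a b α := by
  rw [gamma₂, gamma₂, Finset.sum_mul, Finset.mul_sum]
  refine Finset.sum_congr rfl fun j hj => ?_
  have hj' := Finset.mem_range.1 hj
  simp only [tau₁, mul_sub, sub_mul, smul_mul_assoc, mul_smul_comm, tens_mul, one_mul,
    mul_one, x_mul_y_pow, tens_smul_left, tens_smul_right, smul_sub, smul_smul]
  have hb : b = (b - 1 - j) + j + 1 := by omega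
  congr 2
  · rw [show q ^ (β + b) = q ^ (β + ((b - 1 - j) + j + 1)) by rw [← hb]]
    ring
  · ring

lemma tau₂_mul_gamma₁ (α β : ℕ) : tau₂ k q a b (α + a) * gamma₁ k q a b β =
    gamma₁ k q a b (β + 1) * tau₂ k q a b (α + 1) := by
  rw [gamma₁, gamma₁, Finset.sum_mul, Finset.mul_sum]
  refine Finset.sum_congr rfl fun j hj => ?_
  have hj' := Finset.mem_range.1 hj
  simp only [tau₂, mul_sub, sub_mul, smul_mul_assoc, mul_smul_comm, tens_mul, one_mul,
    mul_one, x_pow_mul_y, tens_smul_left, tens_smul_right, smul_sub, smul_smul]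
  have ha : a = (a - 1 - j) + j + 1 := by omega
  congr 2
  · ring
  · rw [show q ^ (α + a) = q ^ (α + ((a - 1 - j) + j + 1)) by rw [← ha]]
    ring

lemma gamma₂_mul_gamma₁ (α β : ℕ) : gamma₂ k q a b (α + a) * gamma₁ k q a b (β + 1) =
    gamma₁ k q a b (β + b) * gamma₂ k q a b (α + 1) := by
  rw [gamma₁, gamma₁, gamma₂, gamma₂, Finset.sum_mul_sum, Finset.sum_mul_sum, Finset.sum_comm]
  refine Finset.sum_congr rfl fun i hi => Finset.sum_congr rfl fun j hj => ?_
  have hi' := Finset.mem_range.1 hi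
  have hj' := Finset.mem_range.1 hj
  simp only [smul_mul_assoc, mul_smul_comm, tens_mul, x_pow_mul_y_pow, tens_smul_left,
    tens_smul_right, smul_smul]
  have ha : a = (a - 1 - i) + i + 1 := by omega
  have hb : b = (b - 1 - j) + j + 1 := by omega
  congr 1
  rw [show q ^ (j * (α + a)) = q ^ (j * (α + ((a - 1 - i) + i + 1))) by rw [← ha],
    show q ^ (i * (β + b)) = q ^ (i * (β + ((b - 1 - j) + j + 1))) by rw [← hb]]
  ring

end Coefficients

/-! ### The expansions of `Aᵉ` over `rightY` and of `rightY` over A ⊗ 1 -/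

section Exactness

variable {k : Type*} [Field k] {q : k} {a b : ℕ}

variable (k q a b) in
/-- The additive subgroup of `Aᵉ` spanned by the elements `w ⊗ y ^ l`. -/
def rightY : AddSubgroup (Env k q a b) :=
  AddSubgroup.closure {s | ∃ w l, s = tens k q a b w (y k q a b ^ l)}

variable (k q a b) in
/-- The additive subgroup `A ⊗ 1` of `Aᵉ`. -/
def leftFactor : AddSubgroup (Env k q a b) :=
  (AddMonoidHom.mk' (fun w => tens k q a b w 1) fun w w' => tens_add_left w w' 1).range

lemma tens_mem_rightY (w : Alg k q a b) (l : ℕ) :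
    tens k q a b w (y k q a b ^ l) ∈ rightY k q a b :=
  AddSubgroup.subset_closure ⟨w, l, rfl⟩

lemma mul_mem_rightY {c : Env k q a b}
    (hc : ∀ w l, tens k q a b w (y k q a b ^ l) * c ∈ rightY k q a b) :
    ∀ s ∈ rightY k q a b, s * c ∈ rightY k q a b := by
  intro s hs
  induction hs using AddSubgroup.closure_induction with
  | mem _ h => obtain ⟨w, l, rfl⟩ := h; exact hc w l
  | zero => simp
  | add u v _ _ hu hv => rw [add_mul]; exact add_mem hu hv
  | neg u _ hu => rw [neg_mul]; exact neg_mem hu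

lemma mul_left_mem_rightY (z : Alg k q a b) :
    ∀ s ∈ rightY k q a b, s * tens k q a b z 1 ∈ rightY k q a b :=
  mul_mem_rightY fun w l => by
    rw [tens_mul, one_mul]; exact tens_mem_rightY _ _

lemma mul_right_y_mem_rightY :
    ∀ s ∈ rightY k q a b, s * tens k q a b 1 (y k q a b) ∈ rightY k q a b :=
  mul_mem_rightY fun w l => by
    rw [tens_mul, ← pow_succ']; exact tens_mem_rightY _ _

/-- With `mul_gamma₂_zero_mem_rightY`, this lets column 0, whose twist is 0, act on the cokernels of
the rows. -/
lemma mul_tau₂_zero_mem_rightY :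
    ∀ s ∈ rightY k q a b, s * tau₂ k q a b 0 ∈ rightY k q a b := by
  intro s hs
  rw [tau₂, pow_zero, one_smul, mul_sub]
  exact sub_mem (mul_right_y_mem_rightY s hs) (mul_left_mem_rightY _ s hs)

lemma mul_gamma₂_zero_mem_rightY :
    ∀ s ∈ rightY k q a b, s * gamma₂ k q a b 0 ∈ rightY k q a b := by
  intro s hs
  rw [gamma₂, Finset.mul_sum]
  refine sum_mem fun j _ => ?_
  rw [mul_zero, pow_zero, one_smul]
  exact mul_mem_rightY (fun w l => by rw [tens_mul, ← pow_add]; exact tens_mem_rightY _ _) s hs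

lemma mul_mem_leftFactor (z : Alg k q a b) :
    ∀ s ∈ leftFactor k q a b, s * tens k q a b z 1 ∈ leftFactor k q a b := by
  rintro _ ⟨w, rfl⟩
  exact ⟨w * z, by simp [tens_mul]⟩

lemma exists_of_mem_rightY {s : Env k q a b} (hs : s ∈ rightY k q a b) :
    ∃ w : ℕ → Alg k q a b, s = ∑ l ∈ Finset.range b, tens k q a b (w l) (y k q a b ^ l) := by
  induction hs using AddSubgroup.closure_induction with
  | mem _ h =>
    obtain ⟨w, l, rfl⟩ := h
    by_cases hl : l < b
    · refine ⟨fun i => if i = l then w else 0, ?_⟩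
      rw [Finset.sum_eq_single l]
      · simp
      · intro i _ hi; dsimp only; rw [if_neg hi, tens_zero_left]
      · intro h; exact absurd (Finset.mem_range.2 hl) h
    · refine ⟨fun _ => 0, ?_⟩
      rw [show l = b + (l - b) by omega, pow_add, y_pow, zero_mul, tens_zero_right]
      simp [tens_zero_left]
  | zero => exact ⟨fun _ => 0, by simp [tens_zero_left]⟩
  | add u v _ _ hu hv =>
    obtain ⟨w, rfl⟩ := hu
    obtain ⟨w', rfl⟩ := hv
    exact ⟨fun l => w l + w' l, by simp only [tens_add_left, Finset.sum_add_distrib]⟩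
  | neg u _ hu =>
    obtain ⟨w, rfl⟩ := hu
    refine ⟨fun l => -w l, ?_⟩
    rw [← Finset.sum_neg_distrib]
    refine Finset.sum_congr rfl fun l _ => ?_
    dsimp only
    rw [← neg_one_smul k (w l), tens_smul_left, neg_one_smul]

lemma isExpansion_rightY (hq : q ≠ 0) (ha : a ≠ 0) (hb : b ≠ 0) :
    IsExpansion (rightY k q a b) (leftFactor k q a b) (tens k q a b 1 (y k q a b)) b where
  exists_eq s hs := by
    obtain ⟨w, rfl⟩ := exists_of_mem_rightY hs
    refine ⟨fun l => tens k q a b (w l) 1, fun l => ⟨w l, rfl⟩, ?_⟩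
    simp [tens_pow, tens_mul]
  eq_zero c hc h l hl := by
    choose w hw using hc
    have hw' : ∀ l, c l = tens k q a b (w l) 1 := fun l => (hw l).symm
    have h1 := env_independent hq ha hb (fun j l => if j = 0 then w l else 0) (by
      rw [Finset.sum_eq_single 0]
      · rw [← h]
        refine Finset.sum_congr rfl fun l _ => ?_
        simp [hw', tens_pow, tens_mul]
      · intro j _ hj
        simp [hj, tens_zero_left]
      · intro h; exact absurd (Finset.mem_range.2 (by omega)) h) (j := 0) (by omega) hl
    rw [if_pos rfl] at h1
    rw [hw', h1, tens_zero_left]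

/-- Multiplication in the second factor is reversed, so w ⊗ x^j y^l = (w ⊗ y^l)(1 ⊗ x^j). The unit
q^(sj) is absorbed into the coefficient. -/
lemma isExpansion_top (hq : q ≠ 0) (ha : a ≠ 0) (hb : b ≠ 0) (s : ℕ) :
    IsExpansion ⊤ (rightY k q a b) (q ^ s • tens k q a b 1 (x k q a b)) a where
  exists_eq t _ := by
    induction t using env_induction hq with
    | h0 => exact ⟨fun _ => 0, fun _ => zero_mem _, by simp⟩
    | hadd u v hu hv =>
      obtain ⟨c, hc, rfl⟩ := hu trivial
      obtain ⟨c', hc', rfl⟩ := hv trivial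
      exact ⟨fun j => c j + c' j, fun j => add_mem (hc j) (hc' j),
        by simp only [add_mul, Finset.sum_add_distrib]⟩
    | hm w j l =>
      by_cases hj : j < a
      · refine ⟨fun i => if i = j then tens k q a b (((q ^ s) ^ j)⁻¹ • w) (y k q a b ^ l) else 0,
          fun i => ?_, ?_⟩
        · dsimp only
          split_ifs
          exacts [tens_mem_rightY _ _, zero_mem _]
        · rw [Finset.sum_eq_single j]
          · dsimp only
            rw [if_pos rfl, smul_pow, mul_smul_comm, tens_pow, tens_mul, one_pow, mul_one,
              tens_smul_left, smul_smul, mul_inv_cancel₀ (pow_ne_zero _ (pow_ne_zero _ hq)), one_smul]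
          · intro i _ hi; dsimp only; rw [if_neg hi, zero_mul]
          · intro h; exact absurd (Finset.mem_range.2 hj) h
      · refine ⟨fun _ => 0, fun _ => zero_mem _, ?_⟩
        rw [show j = a + (j - a) by omega, pow_add, x_pow, zero_mul, zero_mul, tens_zero_right]
        simp
  eq_zero c hc h j hj := by
    choose w hw using fun j => exists_of_mem_rightY (hc j)
    have h0 : ∑ j ∈ Finset.range a, ∑ l ∈ Finset.range b,
        tens k q a b ((q ^ s) ^ j • w j l) (x k q a b ^ j * y k q a b ^ l) = 0 := by
      rw [← h]
      refine Finset.sum_congr rfl fun j _ => ?_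
      rw [hw, Finset.sum_mul]
      refine Finset.sum_congr rfl fun l _ => ?_
      simp [smul_pow, tens_pow, tens_mul, tens_smul_left]
    rw [hw]
    refine Finset.sum_eq_zero fun l hl => ?_
    have h2 := env_independent hq ha hb (fun j l => (q ^ s) ^ j • w j l) h0 hj
      (Finset.mem_range.1 hl)
    rw [smul_eq_zero_iff_right (pow_ne_zero _ (pow_ne_zero _ hq))] at h2
    rw [h2, tens_zero_left]

end Exactness

/-! ### Exactness of the rows and of the column of their cokernels -/

section RowsAndColumns

variable {k : Type*} [Field k] {q : k} {a b : ℕ}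

lemma exists_eq_mul_gamma₁ (hq : q ≠ 0) (ha : a ≠ 0) (hb : b ≠ 0) {s : ℕ} {w : Env k q a b}
    (h : w * tau₁ k q a b s = 0) : ∃ r, w = r * gamma₁ k q a b s := by
  obtain ⟨n, -, hn⟩ := (isExpansion_top hq ha hb s).exists_eq_mul_geom_sum ha
    (mul_left_mem_rightY (x k q a b)) ((commute_left_right _ _).smul_right _)
    (by rw [smul_pow, pow_right_x, smul_zero]) (AddSubgroup.mem_top w) h
  exact ⟨n, by rw [gamma₁_eq]; exact hn⟩

lemma exists_eq_add_mul_tau₁ (hq : q ≠ 0) (ha : a ≠ 0) (hb : b ≠ 0) (s : ℕ) (w : Env k q a b) :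
    ∃ n ∈ rightY k q a b, ∃ r, w = n + r * tau₁ k q a b s :=
  (isExpansion_top hq ha hb s).exists_eq_add_mul_sub
    (mul_left_mem_rightY (x k q a b)) ((commute_left_right _ _).smul_right _)
    (AddSubgroup.mem_top w)

lemma eq_zero_of_mul_gamma₁ (hq : q ≠ 0) (ha : a ≠ 0) (hb : b ≠ 0) {s : ℕ} {n : Env k q a b}
    (hn : n ∈ rightY k q a b) (h : n * gamma₁ k q a b s = 0) : n = 0 := by
  rw [gamma₁_eq] at h
  exact (isExpansion_top hq ha hb s).eq_zero_of_mul_geom_sum ha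
    (mul_left_mem_rightY (x k q a b)) hn h

/-- Together with `exists_eq_add_mul_tau₁`, this makes `rightY` a complement of the left ideal
generated by τ₁, hence a model for the cokernel of a row. -/
lemma eq_zero_of_eq_mul_tau₁ (hq : q ≠ 0) (ha : a ≠ 0) (hb : b ≠ 0) {s : ℕ} {n r : Env k q a b}
    (hn : n ∈ rightY k q a b) (h : n = r * tau₁ k q a b s) : n = 0 :=
  eq_zero_of_mul_gamma₁ (s := s) hq ha hb hn (by rw [h, mul_assoc, tau₁_mul_gamma₁, mul_zero])

/-- Modulo multiples of τ₁, which γ₁ kills, `w` lies in `rightY`, where multiplication by γ₁ is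
injective. -/
lemma exists_eq_mul_tau₁ (hq : q ≠ 0) (ha : a ≠ 0) (hb : b ≠ 0) {s : ℕ} {w : Env k q a b}
    (h : w * gamma₁ k q a b s = 0) : ∃ r, w = r * tau₁ k q a b s := by
  obtain ⟨n, hn, r, rfl⟩ := exists_eq_add_mul_tau₁ hq ha hb s w
  rw [add_mul, mul_assoc, tau₁_mul_gamma₁, mul_zero, add_zero] at h
  exact ⟨r, by rw [eq_zero_of_mul_gamma₁ hq ha hb hn h, zero_add]⟩

lemma exists_eq_mul_gamma₂ (hq : q ≠ 0) (ha : a ≠ 0) (hb : b ≠ 0) {n : Env k q a b}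
    (hn : n ∈ rightY k q a b) (h : n * tau₂ k q a b 0 = 0) : ∃ r, n = r * gamma₂ k q a b 0 := by
  rw [tau₂, pow_zero, one_smul] at h
  obtain ⟨r, -, hr⟩ := (isExpansion_rightY hq ha hb).exists_eq_mul_geom_sum hb
    (mul_mem_leftFactor (y k q a b)) (commute_left_right _ _) pow_right_y hn h
  exact ⟨r, by rw [gamma₂_eq, pow_zero, one_smul]; exact hr⟩

lemma exists_eq_add_mul_tau₂ (hq : q ≠ 0) (ha : a ≠ 0) (hb : b ≠ 0) {n : Env k q a b}
    (hn : n ∈ rightY k q a b) : ∃ w r, n = tens k q a b w 1 + r * tau₂ k q a b 0 := by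
  obtain ⟨_, ⟨w, rfl⟩, r, hr⟩ := (isExpansion_rightY hq ha hb).exists_eq_add_mul_sub
    (mul_mem_leftFactor (y k q a b)) (commute_left_right _ _) hn
  exact ⟨w, r, by rw [tau₂, pow_zero, one_smul]; exact hr⟩

lemma exists_eq_mul_tau₂ (hq : q ≠ 0) (ha : a ≠ 0) (hb : b ≠ 0) {n : Env k q a b}
    (hn : n ∈ rightY k q a b) (h : n * gamma₂ k q a b 0 = 0) : ∃ r, n = r * tau₂ k q a b 0 := by
  obtain ⟨w, r, rfl⟩ := exists_eq_add_mul_tau₂ hq ha hb hn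
  rw [add_mul, mul_assoc, tau₂_mul_gamma₂, mul_zero, add_zero, gamma₂_eq, pow_zero, one_smul] at h
  refine ⟨r, ?_⟩
  have hw : tens k q a b w 1 = 0 := (isExpansion_rightY hq ha hb).eq_zero_of_mul_geom_sum hb
    (mul_mem_leftFactor (y k q a b)) ⟨w, rfl⟩ h
  rw [hw, zero_add]

lemma exists_eq_mul_rowCoeff (hq : q ≠ 0) (ha : a ≠ 0) (hb : b ≠ 0) {i j : ℕ} {w : Env k q a b}
    (h : w * rowCoeff k q a b i j = 0) : ∃ r, w = r * rowCoeff k q a b (i + 1) j := by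
  unfold rowCoeff at *
  by_cases hi : Even i
  · rw [if_pos hi] at h
    rw [if_neg (by simpa [Nat.even_add_one] using hi)]
    exact exists_eq_mul_tau₁ hq ha hb h
  · rw [if_neg hi] at h
    rw [if_pos (by simpa [Nat.even_add_one] using hi)]
    exact exists_eq_mul_gamma₁ hq ha hb h

lemma rowCoeff_mul_rowCoeff (i j : ℕ) :
    rowCoeff k q a b (i + 1) j * rowCoeff k q a b i j = 0 := by
  unfold rowCoeff
  by_cases hi : Even i
  · rw [if_pos hi, if_neg (by simpa [Nat.even_add_one] using hi), tau₁_mul_gamma₁]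
  · rw [if_neg hi, if_pos (by simpa [Nat.even_add_one] using hi), gamma₁_mul_tau₁]

lemma colCoeff_mul_colCoeff (i j : ℕ) :
    colCoeff k q a b i (j + 1) * colCoeff k q a b i j = 0 := by
  unfold colCoeff
  by_cases hj : Even j
  · have hj' : ¬ Even (j + 1) := by simpa [Nat.even_add_one] using hj
    simp only [if_pos hj, if_neg hj']
    split_ifs <;> simp [tau₂_mul_gamma₂]
  · have hj' : Even (j + 1) := by simpa [Nat.even_add_one] using hj
    simp only [if_pos hj', if_neg hj]
    split_ifs <;> simp [gamma₂_mul_tau₂]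

lemma twist_even (m r : ℕ) : twist m (r + r) = m * r := by
  simp [twist, show (r + r) / 2 = r by omega, show (r + r) % 2 = 0 by omega]

lemma twist_odd (m r : ℕ) : twist m (2 * r + 1) = m * r + 1 := by
  simp [twist, show (2 * r + 1) / 2 = r by omega, show (2 * r + 1) % 2 = 1 by omega]

lemma twist_even_succ (m r : ℕ) : twist m (r + r + 1) = m * r + 1 := by
  rw [← two_mul, twist_odd]

lemma twist_odd_succ (m r : ℕ) : twist m (2 * r + 1 + 1) = m * r + m := by
  rw [show 2 * r + 1 + 1 = (r + 1) + (r + 1) by ring, twist_even, mul_add, mul_one]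

/-- The twists make the square commute up to sign; exactly one of two adjacent columns carries a
minus sign. -/
lemma colCoeff_mul_rowCoeff (i j : ℕ) :
    colCoeff k q a b (i + 1) (j + 1) * rowCoeff k q a b (i + 1) j =
      -(rowCoeff k q a b (i + 1) (j + 1) * colCoeff k q a b i (j + 1)) := by
  unfold rowCoeff colCoeff
  rcases Nat.even_or_odd i with hi | hi <;> rcases Nat.even_or_odd j with hj | hj
  · rw [if_neg (by simpa [Nat.even_add_one] using hi), if_neg (by simpa [Nat.even_add_one] using hj),
      if_neg (by simpa [Nat.even_add_one] using hi), if_neg (by simpa [Nat.even_add_one] using hi),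
      if_pos hi, if_neg (by simpa [Nat.even_add_one] using hj)]
    obtain ⟨r, rfl⟩ := hi
    obtain ⟨t, rfl⟩ := hj
    rw [twist_even, twist_even, twist_even_succ, twist_even_succ, neg_mul, tau₂_mul_tau₁]
  · rw [if_neg (by simpa [Nat.even_add_one] using hi), if_pos (by simpa [Nat.even_add_one] using hj),
      if_neg (by simpa [Nat.even_add_one] using hi), if_neg (by simpa [Nat.even_add_one] using hi),
      if_pos hi, if_pos (by simpa [Nat.even_add_one] using hj)]
    obtain ⟨r, rfl⟩ := hi
    obtain ⟨t, rfl⟩ := hj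
    rw [twist_even, twist_even_succ, twist_odd, twist_odd_succ, neg_mul, gamma₂_mul_tau₁]
  · rw [if_pos (by simpa [Nat.even_add_one] using hi), if_neg (by simpa [Nat.even_add_one] using hj),
      if_pos (by simpa [Nat.even_add_one] using hi), if_pos (by simpa [Nat.even_add_one] using hi),
      if_neg (by simpa using hi), if_neg (by simpa [Nat.even_add_one] using hj)]
    obtain ⟨r, rfl⟩ := hi
    obtain ⟨t, rfl⟩ := hj
    rw [twist_odd, twist_odd_succ, twist_even, twist_even_succ, mul_neg, neg_neg, tau₂_mul_gamma₁]
  · rw [if_pos (by simpa [Nat.even_add_one] using hi), if_pos (by simpa [Nat.even_add_one] using hj),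
      if_pos (by simpa [Nat.even_add_one] using hi), if_pos (by simpa [Nat.even_add_one] using hi),
      if_neg (by simpa using hi), if_pos (by simpa [Nat.even_add_one] using hj)]
    obtain ⟨r, rfl⟩ := hi
    obtain ⟨t, rfl⟩ := hj
    rw [twist_odd, twist_odd_succ, twist_odd, twist_odd_succ, mul_neg, neg_neg, gamma₂_mul_gamma₁]

lemma rowCoeff_one (j : ℕ) : rowCoeff k q a b 1 j = tau₁ k q a b (twist b j) := by
  simp [rowCoeff]

lemma colCoeff_zero (j : ℕ) :
    colCoeff k q a b 0 j = if Even j then gamma₂ k q a b 0 else tau₂ k q a b 0 := by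
  simp [colCoeff, twist]

lemma mul_colCoeff_zero_mem_rightY (j : ℕ) {n : Env k q a b} (hn : n ∈ rightY k q a b) :
    n * colCoeff k q a b 0 j ∈ rightY k q a b := by
  rw [colCoeff_zero]
  split_ifs
  exacts [mul_gamma₂_zero_mem_rightY n hn, mul_tau₂_zero_mem_rightY n hn]

lemma exists_eq_mul_colCoeff_zero (hq : q ≠ 0) (ha : a ≠ 0) (hb : b ≠ 0) {j : ℕ}
    {n : Env k q a b} (hn : n ∈ rightY k q a b) (h : n * colCoeff k q a b 0 j = 0) :
    ∃ r, n = r * colCoeff k q a b 0 (j + 1) := by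
  rw [colCoeff_zero] at *
  by_cases hj : Even j
  · rw [if_pos hj] at h
    rw [if_neg (by simpa [Nat.even_add_one] using hj)]
    exact exists_eq_mul_tau₂ hq ha hb hn h
  · rw [if_neg hj] at h
    rw [if_pos (by simpa [Nat.even_add_one] using hj)]
    exact exists_eq_mul_gamma₂ hq ha hb hn h

/-- The column of cokernels of the rows is exact in positive degrees. -/
lemma exists_eq_of_mul_colCoeff_zero (hq : q ≠ 0) (ha : a ≠ 0) (hb : b ≠ 0) {j : ℕ}
    {w r : Env k q a b}
    (h : w * colCoeff k q a b 0 (j + 1) + r * rowCoeff k q a b 1 j = 0) :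
    ∃ r₁ r₂, w = r₁ * colCoeff k q a b 0 (j + 2) + r₂ * rowCoeff k q a b 1 (j + 1) := by
  -- Here `n` represents the class of `w` in the cokernel of row j + 1.
  obtain ⟨n, hn, m, rfl⟩ := exists_eq_add_mul_tau₁ hq ha hb (twist b (j + 1)) w
  rw [← rowCoeff_one] at h ⊢
  have h1 := colCoeff_mul_rowCoeff (k := k) (q := q) (a := a) (b := b) 0 j
  rw [zero_add, eq_neg_iff_add_eq_zero, add_comm, ← eq_neg_iff_add_eq_zero] at h1
  -- Anticommutation moves the row multiple in `w` into the image of row `j`, so this element of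
  -- `rightY` is a multiple of τ₁ and vanishes.
  have h2 : n * colCoeff k q a b 0 (j + 1) =
      (m * colCoeff k q a b 1 (j + 1) - r) * rowCoeff k q a b 1 j := by
    rw [add_mul, mul_assoc, h1] at h
    rw [sub_mul, mul_assoc, ← sub_eq_zero, ← h, mul_neg]
    abel
  rw [rowCoeff_one] at h2
  have h3 := eq_zero_of_eq_mul_tau₁ hq ha hb (mul_colCoeff_zero_mem_rightY _ hn) h2
  obtain ⟨r₁, rfl⟩ := exists_eq_mul_colCoeff_zero hq ha hb hn h3
  exact ⟨r₁, m, rfl⟩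

/-! ### Exactness of the total complex and of the augmentation -/

lemma d_apply (n : ℕ) (z : P k q a b (n + 1)) (l : Fin (n + 1)) :
    d k q a b n z l = z l.castSucc * colCoeff k q a b l (n - l + 1) +
      z l.succ * rowCoeff k q a b (l + 1) (n - l) := by
  have hl := l.2
  simp only [d, Fintype.linearCombination_apply, Finset.sum_apply, Pi.smul_apply, Pi.add_apply,
    smul_eq_mul, mul_add, Finset.sum_add_distrib, gen]
  congr 1
  · rw [Finset.sum_eq_single l.castSucc]
    · simp [show n - (l : ℕ) + 1 = n + 1 - l by omega]
    · intro i _ hi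
      rw [if_neg, mul_zero, mul_zero]
      intro h
      exact hi (Fin.ext (by simpa using h.symm))
    · simp
  · rw [Finset.sum_eq_single l.succ]
    · simp
    · intro i _ hi
      rw [if_neg, mul_zero, mul_zero]
      intro h
      exact hi (Fin.ext (by rw [Fin.val_succ]; omega))
    · simp

lemma mu_apply (z : P k q a b 0) : mu k q a b z = z 0 • (1 : Alg k q a b) := by
  simp [mu, Fintype.linearCombination_apply]

lemma d_comp_d (n : ℕ) (z : P k q a b (n + 2)) : d k q a b n (d k q a b (n + 1) z) = 0 := by
  funext l
  have hl := l.2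
  rw [d_apply, d_apply, d_apply, Pi.zero_apply, Fin.val_castSucc, Fin.val_succ, ← Fin.succ_castSucc]
  rw [show n + 1 - ((l : ℕ) + 1) = n - l by omega, show n + 1 - (l : ℕ) = n - l + 1 by omega]
  generalize n - (l : ℕ) = j
  rw [add_mul, add_mul, mul_assoc, mul_assoc, mul_assoc, mul_assoc, colCoeff_mul_colCoeff,
    rowCoeff_mul_rowCoeff, colCoeff_mul_rowCoeff]
  simp

/-- Boundaries are subtracted to clear entries in increasing order of index; `e` counts the entries
still to be cleared. -/
lemma exists_d_eq_of_forall_lt (hq : q ≠ 0) (ha : a ≠ 0) (hb : b ≠ 0) (n e m : ℕ)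
    (hem : e + m = n + 2) (z : P k q a b (n + 1)) (hz : d k q a b n z = 0)
    (h0 : ∀ i : Fin (n + 2), (i : ℕ) < m → z i = 0) : ∃ w, d k q a b (n + 1) w = z := by
  induction e generalizing m z with
  | zero => exact ⟨0, by rw [map_zero]; exact funext fun i => (h0 i (by omega)).symm⟩
  | succ e ih =>
    suffices h : ∃ w, ∀ i : Fin (n + 2), (i : ℕ) < m + 1 → (z - d k q a b (n + 1) w) i = 0 by
      obtain ⟨w, hw⟩ := h
      obtain ⟨w', hw'⟩ := ih (m + 1) (by omega) (z - d k q a b (n + 1) w)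
        (by rw [map_sub, hz, d_comp_d, sub_zero]) hw
      exact ⟨w' + w, by rw [map_add, hw', sub_add_cancel]⟩
    cases m with
    | zero =>
      have h1 := congrFun hz 0
      rw [d_apply] at h1
      obtain ⟨r₁, r₂, hr⟩ := exists_eq_of_mul_colCoeff_zero hq ha hb h1
      -- Entry 0 of this boundary is exactly the combination in `hr`; later entries may change
      -- freely.
      refine ⟨Pi.single 0 r₁ + Pi.single 1 r₂, fun i hi => ?_⟩
      obtain rfl : i = 0 := Fin.ext (by simpa using hi)
      rw [Pi.sub_apply, d_apply, sub_eq_zero]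
      simp only [Fin.castSucc_zero, Fin.succ_zero_eq_one] at hr ⊢
      rw [hr]
      simp
    | succ p =>
      have h1 := congrFun hz ⟨p, by omega⟩
      -- As entry `p` of `z` vanishes, entry `p` of `d z = 0` involves only the row map on entry p +
      -- 1, so exactness of the row applies.
      rw [d_apply, h0 _ (by simp), zero_mul, zero_add] at h1
      obtain ⟨r, hr⟩ := exists_eq_mul_rowCoeff hq ha hb h1
      -- The boundary of an element supported at p + 2 lives in entries p + 1 and p + 2, so the
      -- cleared entries stay zero.
      refine ⟨Pi.single ⟨p + 2, by omega⟩ r, fun i hi => ?_⟩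
      rw [Pi.sub_apply, d_apply, sub_eq_zero, Pi.single_eq_of_ne (by simp [Fin.ext_iff]; omega),
        zero_mul, zero_add]
      obtain hi' | hi' := Nat.lt_succ_iff_lt_or_eq.1 hi
      · rw [Pi.single_eq_of_ne (by simp [Fin.ext_iff]; omega), zero_mul, h0 i hi']
      · have hip : i = ⟨p + 1, by omega⟩ := Fin.ext hi'
        rw [hip]
        have h2 : (Fin.succ ⟨p + 1, by omega⟩ : Fin (n + 3)) = ⟨p + 2, by omega⟩ := rfl
        rw [h2, Pi.single_eq_same]
        dsimp only at hr ⊢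
        rw [show n + 1 - (p + 1) = n - p by omega]
        exact hr

lemma exact_d_d (hq : q ≠ 0) (ha : a ≠ 0) (hb : b ≠ 0) (n : ℕ) :
    Function.Exact (d k q a b (n + 1)) (d k q a b n) := by
  intro z
  constructor
  · intro hz
    exact exists_d_eq_of_forall_lt hq ha hb n (n + 2) 0 rfl z hz fun i hi => absurd hi (by omega)
  · rintro ⟨w, rfl⟩
    exact d_comp_d n w

lemma tau₁_smul_one : tau₁ k q a b 0 • (1 : Alg k q a b) = 0 := by
  rw [tau₁, pow_zero, one_smul, sub_smul, tens_smul, tens_smul]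
  simp

lemma tau₂_smul_one : tau₂ k q a b 0 • (1 : Alg k q a b) = 0 := by
  rw [tau₂, pow_zero, one_smul, sub_smul, tens_smul, tens_smul]
  simp

lemma exact_d_mu (hq : q ≠ 0) (ha : a ≠ 0) (hb : b ≠ 0) :
    Function.Exact (d k q a b 0) (mu k q a b) := by
  have hd (w : P k q a b 1) :
      d k q a b 0 w 0 = w 0 * tau₂ k q a b 0 + w 1 * tau₁ k q a b 0 := by
    rw [d_apply]
    simp [colCoeff_zero, rowCoeff_one, twist]
  intro z
  rw [mu_apply]
  constructor
  · intro hz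
    obtain ⟨n, hn, r, hr⟩ := exists_eq_add_mul_tau₁ hq ha hb 0 (z 0)
    obtain ⟨w, r', rfl⟩ := exists_eq_add_mul_tau₂ hq ha hb hn
    -- Both τ(0) annihilate 1, so μ sees only the component w ⊗ 1 and forces w = 0.
    rw [hr, add_smul, add_smul, mul_smul, mul_smul, tau₁_smul_one, tau₂_smul_one, tens_smul] at hz
    simp only [mul_one, smul_zero, add_zero] at hz
    rw [hz, tens_zero_left] at hr
    refine ⟨![r', r], funext fun i => ?_⟩
    obtain rfl := Fin.eq_zero i
    refine (hd _).trans (Eq.trans ?_ hr.symm)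
    simp
  · rintro ⟨w, rfl⟩
    rw [hd, add_smul, mul_smul, mul_smul, tau₁_smul_one, tau₂_smul_one, smul_zero, smul_zero,
      add_zero]

lemma surjective_mu : Function.Surjective (mu k q a b) := fun w =>
  ⟨fun _ => tens k q a b w 1, by rw [mu_tens, mul_one]⟩

end RowsAndColumns

/-! ### Minimality through the Jacobson radical -/

section Minimality

/-- Nakayama: a proper submodule of a finite module lies in a maximal one, which also contains the
radical. -/
lemma isSuperfluous_of_le_jacobson {R : Type*} [Ring R] {P : Type*} [AddCommGroup P] [Module R P]
    [Module.Finite R P] {N : Submodule R P} (h : N ≤ Module.jacobson R P) : IsSuperfluous N := by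
  intro K hK
  by_contra hne
  obtain ⟨m, hm, hKm⟩ := (eq_top_or_exists_le_coatom K).resolve_left hne
  have hN : N ≤ m := h.trans (sInf_le hm)
  exact hm.1 (top_le_iff.1 (hK ▸ sup_le hN hKm))

/-- A nilpotent element `u` with `u R ⊆ R u` lies in the Jacobson radical. -/
lemma mem_jacobson_of_normal {R : Type*} [Ring R] {u : R} (hu : IsNilpotent u)
    (h : ∀ s, ∃ s', u * s = s' * u) : u ∈ Ring.jacobson R := by
  obtain ⟨n, hn⟩ := hu
  -- Normality collects all factors `u` on the right, so `r * u` is nilpotent and `r * u + 1` is a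
  -- unit.
  have hpow (r : R) (i : ℕ) : ∃ r', (r * u) ^ i = r' * u ^ i := by
    induction i with
    | zero => exact ⟨1, by simp⟩
    | succ i ih =>
      obtain ⟨r', hr'⟩ := ih
      have key : ∀ i s, ∃ s', u ^ i * s = s' * u ^ i := by
        intro i
        induction i with
        | zero => exact fun s => ⟨s, by simp⟩
        | succ i ih =>
          intro s
          obtain ⟨s', hs'⟩ := h s
          obtain ⟨t, ht⟩ := ih s'
          exact ⟨t, by rw [pow_succ, mul_assoc, hs', ← mul_assoc, ht, mul_assoc]⟩
      obtain ⟨s', hs'⟩ := key i r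
      exact ⟨r' * s', by rw [pow_succ, hr', mul_assoc, ← mul_assoc _ r, hs', pow_succ]; noncomm_ring⟩
  rw [← Ideal.jacobson_bot, Ideal.mem_jacobson_iff]
  intro r
  have hnil : IsNilpotent (r * u) := by
    obtain ⟨r', hr'⟩ := hpow r n
    exact ⟨n, by rw [hr', hn, mul_zero]⟩
  obtain ⟨t, ht⟩ := hnil.isUnit_add_one
  refine ⟨(t⁻¹ : Rˣ), ?_⟩
  have h1 : ((t⁻¹ : Rˣ) : R) * (r * u + 1) = 1 := by rw [← ht, Units.inv_mul]
  rw [mul_add, mul_one, ← mul_assoc] at h1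
  rw [h1, sub_self]
  exact Submodule.zero_mem _

variable {k : Type*} [Field k] {q : k} {a b : ℕ}

lemma env_induction_monomial (hq : q ≠ 0) {p : Env k q a b → Prop} (h0 : p 0)
    (hadd : ∀ s t, p s → p t → p (s + t))
    (hm : ∀ (c : k) (i m j l : ℕ), p (c • tens k q a b (x k q a b ^ i * y k q a b ^ m)
      (x k q a b ^ j * y k q a b ^ l))) (s : Env k q a b) : p s := by
  refine env_induction hq h0 hadd (fun w j l => ?_) s
  -- A free scalar `c` is introduced so that the induction on `w` can absorb scalars.
  rw [← one_smul k (tens k q a b w _)]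
  generalize (1 : k) = c
  have hw : w ∈ Submodule.span k
      (Set.range fun p : ℕ × ℕ => x k q a b ^ p.1 * y k q a b ^ p.2) := by
    rw [span_monomials hq]; trivial
  induction hw using Submodule.span_induction generalizing c with
  | mem _ h =>
    obtain ⟨⟨i, m⟩, rfl⟩ := h
    exact hm _ _ _ _ _
  | zero => rwa [tens_zero_left, smul_zero]
  | add u v _ _ hu hv =>
    rw [tens_add_left, smul_add]
    exact hadd _ _ (hu _) (hv _)
  | smul c' u _ hu =>
    rw [tens_smul_left, smul_smul]
    exact hu _

/-- Normality is additive in `s`, so it suffices that `u` commutes up to scalars with the monomial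
tensors, which span `Aᵉ`. -/
lemma exists_mul_eq_mul (hq : q ≠ 0) {u : Env k q a b}
    (h : ∀ i m j l : ℕ, ∃ c : k, u * tens k q a b (x k q a b ^ i * y k q a b ^ m)
      (x k q a b ^ j * y k q a b ^ l) = c • (tens k q a b (x k q a b ^ i * y k q a b ^ m)
      (x k q a b ^ j * y k q a b ^ l) * u)) (s : Env k q a b) : ∃ s', u * s = s' * u := by
  induction s using env_induction_monomial hq with
  | h0 => exact ⟨0, by simp⟩
  | hadd s t hs ht =>
    obtain ⟨s', hs⟩ := hs
    obtain ⟨t', ht⟩ := ht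
    exact ⟨s' + t', by rw [mul_add, add_mul, hs, ht]⟩
  | hm c i m j l =>
    obtain ⟨c', hc'⟩ := h i m j l
    exact ⟨c • c' • _, by rw [mul_smul_comm, hc', smul_mul_assoc, smul_mul_assoc]⟩

lemma x_mul_monomial (i m : ℕ) : x k q a b * (x k q a b ^ i * y k q a b ^ m) =
    q ^ m • (x k q a b ^ i * y k q a b ^ m * x k q a b) := by
  rw [← mul_assoc, ← pow_succ', pow_succ, mul_assoc, x_mul_y_pow, mul_smul_comm, mul_assoc]

lemma monomial_mul_y (i m : ℕ) : x k q a b ^ i * y k q a b ^ m * y k q a b =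
    q ^ i • (y k q a b * (x k q a b ^ i * y k q a b ^ m)) := by
  rw [mul_assoc, ← pow_succ, pow_succ', ← mul_assoc, x_pow_mul_y, smul_mul_assoc, mul_assoc]

lemma monomial_mul_x (hq : q ≠ 0) (i m : ℕ) : x k q a b ^ i * y k q a b ^ m * x k q a b =
    (q ^ m)⁻¹ • (x k q a b * (x k q a b ^ i * y k q a b ^ m)) := by
  rw [x_mul_monomial, smul_smul, inv_mul_cancel₀ (pow_ne_zero _ hq), one_smul]

lemma y_mul_monomial (hq : q ≠ 0) (i m : ℕ) : y k q a b * (x k q a b ^ i * y k q a b ^ m) =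
    (q ^ i)⁻¹ • (x k q a b ^ i * y k q a b ^ m * y k q a b) := by
  rw [monomial_mul_y, smul_smul, inv_mul_cancel₀ (pow_ne_zero _ hq), one_smul]

lemma left_x_mem_jacobson (hq : q ≠ 0) :
    tens k q a b (x k q a b) 1 ∈ Ring.jacobson (Env k q a b) :=
  mem_jacobson_of_normal ⟨a, pow_left_x⟩ <| exists_mul_eq_mul hq fun i m j l =>
    ⟨q ^ m, by rw [tens_mul, tens_mul, x_mul_monomial, tens_smul_left, one_mul, mul_one]⟩

lemma right_x_mem_jacobson (hq : q ≠ 0) :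
    tens k q a b 1 (x k q a b) ∈ Ring.jacobson (Env k q a b) :=
  mem_jacobson_of_normal ⟨a, pow_right_x⟩ <| exists_mul_eq_mul hq fun i m j l =>
    ⟨(q ^ l)⁻¹, by rw [tens_mul, tens_mul, monomial_mul_x hq, tens_smul_right, one_mul, mul_one]⟩

lemma left_y_mem_jacobson (hq : q ≠ 0) :
    tens k q a b (y k q a b) 1 ∈ Ring.jacobson (Env k q a b) :=
  mem_jacobson_of_normal ⟨b, pow_left_y⟩ <| exists_mul_eq_mul hq fun i m j l =>
    ⟨(q ^ i)⁻¹, by rw [tens_mul, tens_mul, y_mul_monomial hq, tens_smul_left, one_mul, mul_one]⟩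

lemma right_y_mem_jacobson (hq : q ≠ 0) :
    tens k q a b 1 (y k q a b) ∈ Ring.jacobson (Env k q a b) :=
  mem_jacobson_of_normal ⟨b, pow_right_y⟩ <| exists_mul_eq_mul hq fun i m j l =>
    ⟨q ^ j, by rw [tens_mul, tens_mul, monomial_mul_y, tens_smul_right, one_mul, mul_one]⟩

lemma smul_mem_of_mem {I : Ideal (Env k q a b)} (c : k) {s : Env k q a b} (hs : s ∈ I) :
    c • s ∈ I := by
  rw [← one_mul s, ← smul_mul_assoc]
  exact I.mul_mem_left _ hs

lemma rowCoeff_mem_jacobson (hq : q ≠ 0) (ha : 2 ≤ a) (i j : ℕ) :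
    rowCoeff k q a b i j ∈ Ring.jacobson (Env k q a b) := by
  unfold rowCoeff
  split_ifs
  · refine sum_mem fun t ht => smul_mem_of_mem _ ?_
    -- Each summand has degree a - 1 ≥ 1: for t = 0 a left `x` splits off, otherwise a right one.
    obtain rfl | ht0 := Nat.eq_zero_or_pos t
    · obtain ⟨n, rfl⟩ := Nat.exists_eq_add_of_le ha
      rw [show 2 + n - 1 - 0 = n + 1 by omega, pow_zero]
      have h := (Ring.jacobson (Env k q (2 + n) b)).mul_mem_left
        (tens k q _ b (x k q _ b ^ n) 1) (left_x_mem_jacobson hq)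
      rwa [tens_mul, ← pow_succ, mul_one] at h
    · obtain ⟨n, rfl⟩ := Nat.exists_eq_add_of_le' ht0
      have h := (Ring.jacobson (Env k q a b)).mul_mem_left
        (tens k q a b (x k q a b ^ (a - 1 - (n + 1))) (x k q a b ^ n)) (right_x_mem_jacobson hq)
      rwa [tens_mul, ← pow_succ', mul_one] at h
  · exact sub_mem (smul_mem_of_mem _ (right_x_mem_jacobson hq)) (left_x_mem_jacobson hq)

lemma gamma₂_mem_jacobson (hq : q ≠ 0) (hb : 2 ≤ b) (s : ℕ) :
    gamma₂ k q a b s ∈ Ring.jacobson (Env k q a b) := by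
  refine sum_mem fun t ht => smul_mem_of_mem _ ?_
  obtain rfl | ht0 := Nat.eq_zero_or_pos t
  · obtain ⟨n, rfl⟩ := Nat.exists_eq_add_of_le hb
    rw [show 2 + n - 1 - 0 = n + 1 by omega, pow_zero]
    have h := (Ring.jacobson (Env k q a (2 + n))).mul_mem_left
      (tens k q a _ 1 (y k q a _ ^ n)) (right_y_mem_jacobson hq)
    rwa [tens_mul, ← pow_succ', mul_one] at h
  · obtain ⟨n, rfl⟩ := Nat.exists_eq_add_of_le' ht0
    have h := (Ring.jacobson (Env k q a b)).mul_mem_left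
      (tens k q a b (y k q a b ^ n) (y k q a b ^ (b - 1 - (n + 1)))) (left_y_mem_jacobson hq)
    rwa [tens_mul, ← pow_succ, one_mul] at h

lemma colCoeff_mem_jacobson (hq : q ≠ 0) (hb : 2 ≤ b) (i j : ℕ) :
    colCoeff k q a b i j ∈ Ring.jacobson (Env k q a b) := by
  have h (s : ℕ) : tau₂ k q a b s ∈ Ring.jacobson (Env k q a b) :=
    sub_mem (right_y_mem_jacobson hq) (smul_mem_of_mem _ (left_y_mem_jacobson hq))
  unfold colCoeff
  split_ifs
  exacts [gamma₂_mem_jacobson hq hb _, h _, neg_mem (gamma₂_mem_jacobson hq hb _), neg_mem (h _)]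

lemma d_mem_jacobson (hq : q ≠ 0) (ha : 2 ≤ a) (hb : 2 ≤ b) (n : ℕ) (z : P k q a b (n + 1)) :
    d k q a b n z ∈ Module.jacobson (Env k q a b) (P k q a b n) := by
  refine Ring.jacobson_smul_top_le _ _ ?_
  rw [d, Fintype.linearCombination_apply]
  refine sum_mem fun i _ => Submodule.smul_mem _ _ (add_mem ?_ ?_)
  exacts [Submodule.smul_mem_smul (colCoeff_mem_jacobson hq hb _ _) trivial,
    Submodule.smul_mem_smul (rowCoeff_mem_jacobson hq ha _ _) trivial]

/-- By exactness the kernel is the image of `d n`, whose coefficients all lie in the radical. -/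
lemma isSuperfluous_of_exact (hq : q ≠ 0) (ha : 2 ≤ a) (hb : 2 ≤ b) {n : ℕ} {M : Type*}
    [AddCommGroup M] [Module (Env k q a b) M] {f : P k q a b n →ₗ[Env k q a b] M}
    (h : Function.Exact (d k q a b n) f) : IsSuperfluous (LinearMap.ker f) := by
  refine isSuperfluous_of_le_jacobson fun z hz => ?_
  obtain ⟨w, rfl⟩ := (h z).1 hz
  exact d_mem_jacobson hq ha hb n w

end Minimality

end QuantumCI

end

/-- For `A = k⟨X, Y⟩ / (X ^ a, X Y - q Y X, Y ^ b)` with `q ≠ 0` and `a, b ≥ 2`, the complex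
`⋯ → P_2 → P_1 → P_0 → A → 0` is a minimal projective resolution of the left `Aᵉ`-module `A`;
in particular it is exact. -/
theorem proposition2p1 (k : Type*) [Field k] (q : k) (hq : q ≠ 0) (a b : ℕ)
    (ha : 2 ≤ a) (hb : 2 ≤ b) :
    IsMinimalProjectiveResolution (R := QuantumCI.Env k q a b) (P := QuantumCI.P k q a b)
      (QuantumCI.d k q a b) (QuantumCI.mu k q a b) := by
  have ha0 : a ≠ 0 := by omega
  have hb0 : b ≠ 0 := by omega
  exact
    { surjective := QuantumCI.surjective_mu
      exact_zero := QuantumCI.exact_d_mu hq ha0 hb0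
      exact_succ := QuantumCI.exact_d_d hq ha0 hb0
      projective := fun _ => inferInstance
      superfluous_augmentation :=
        QuantumCI.isSuperfluous_of_exact hq ha hb (QuantumCI.exact_d_mu hq ha0 hb0)
      superfluous := fun n =>
        QuantumCI.isSuperfluous_of_exact hq ha hb (QuantumCI.exact_d_d hq ha0 hb0 n) }
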